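/- **Setting.** There are $K\ge 1$ arms and a known threshold $\mu_0\in\mathbb R$. An instance $\nu=(\nu_1,\dots,\nu_K)$ assigns to each arm $a$ a reward distribution $\nu_a$ on $\mathbb R$ with mean $\mu_a(\nu)$, such that $R-\mu_a(\nu)$ is $1$-sub-Gaussian for $R\sim\nu_a$. It is *positive* if $\max_a\mu_a(\nu)>\mu_0$ and *negative* if $\max_a\mu_a(\nu)<\mu_0$. The correct answers are all arms $a$ with $\mu_a(\nu)\ge\mu_0$ if $\nu$ is positive, and only $\mathsf{None}$ if $\nu$ is negative. A strategy chooses the arm $A_t$ of round $t$ from the history $(A_1,X_1,\dots,A_{t-1},X_{t-1})$ (possibly with randomisation), receives $X_t\sim\nu_{A_t}$, stops at a (possibly infinite) stopping time $\tau$ of the history filtration, and then outputs an answer in $\{1,\dots,K\}\cup\{\mathsf{None}\}$ determined by the history up to $\tau$. Let $N_a(\tau)$ be the number of pulls of arm $a$ up to time $\tau$. A strategy run with tolerance $\delta\in(0,1)$ is *$(\Delta,\delta)$-PAC* if - on every positive or negative instance it stops and gives a correct answer with probability larger than $1-\delta$, and - for every $\Delta>0$, $\sup_\nu\mathbb E_\nu[\tau]<\infty$,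 where $\nu$ ranges over all instances with $|\max_a\mu_a(\nu)-\mu_0|\ge\Delta$. **Theorem.** There is an absolute constant $c>0$ such that the following holds. Fix $K\ge 1$ and reals $\mu_0>\mu_2\ge\mu_3\ge\dots\ge\mu_K$ (for $K=1$ there are no $\mu_a$, and the claim is empty). For every $\delta\in(0,e^{-8})$ and every $(\Delta,\delta)$-PAC strategy with tolerance $\delta$ for the threshold $\mu_0$ there is a $\bar\Delta>0$ such that, for all $\mu_1\in(\mu_0,\mu_0+\bar\Delta]$, on the Gaussian instance $\nu$ with $\nu_a=N(\mu_a,1)$, $a=1,\dots,K$, the strategy satisfies $$\mathbb E_\nu[N_a(\tau)]\;\ge\; c\,\frac{\log\bigl(1/\Delta_{0,1}^2\bigr)}{\Delta_{1,a}^2}\qquad\text{for all } a\in\{2,\dots,K\},$$ where $\Delta_{0,1}=\mu_1-\mu_0$ and $\Delta_{1,a}=\mu_1-\mu_a$. -/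

import Mathlib

open MeasureTheory ProbabilityTheory
open scoped ENNReal NNReal

namespace OneIdentification

/-- A bandit instance with `K` arms: one reward distribution per arm, each of them a probability
measure on `ℝ` whose centred version is `1`-sub-Gaussian. -/
structure BanditInstance (K : ℕ) where
  law : Fin K → Measure ℝ
  isProbabilityMeasure : ∀ a, IsProbabilityMeasure (law a)
  subGaussian : ∀ a, HasSubgaussianMGF (fun x : ℝ => x - ∫ y, y ∂(law a)) 1 (law a)

namespace BanditInstance

variable {K : ℕ}

/-- The mean reward of arm `a`. -/
noncomputable def mean (ν : BanditInstance K) (a : Fin K) : ℝ := ∫ x, x ∂(ν.law a)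

/-- Positive instances for the threshold `μ₀`: the largest mean is above `μ₀`. -/
def IsPositive (ν : BanditInstance K) (μ₀ : ℝ) : Prop := ∃ a, μ₀ < ν.mean a

/-- Negative instances for the threshold `μ₀`: the largest mean is below `μ₀`. -/
def IsNegative (ν : BanditInstance K) (μ₀ : ℝ) : Prop := ∀ a, ν.mean a < μ₀

/-- The largest mean exceeds `μ₀` by at least `Δ`. -/
def IsPositiveWithGap (ν : BanditInstance K) (μ₀ Δ : ℝ) : Prop := ∃ a, Δ ≤ ν.mean a - μ₀

/-- The largest mean is below `μ₀` by at least `Δ`. -/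
def IsNegativeWithGap (ν : BanditInstance K) (μ₀ Δ : ℝ) : Prop := ∀ a, Δ ≤ μ₀ - ν.mean a

/-- The set of correct answers: on a positive instance all arms whose mean is at least `μ₀`, on a
negative instance only the answer `none`. -/
def correctAnswers (ν : BanditInstance K) (μ₀ : ℝ) : Set (Option (Fin K)) :=
  {o | (ν.IsPositive μ₀ ∧ ∃ a, o = some a ∧ μ₀ ≤ ν.mean a) ∨ (ν.IsNegative μ₀ ∧ o = none)}

/-- Pulling arm `a` produces a reward with distribution `ν.law a`. -/
noncomputable def rewardKernel (ν : BanditInstance K) : Kernel (Fin K) ℝ :=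
  Kernel.ofFunOfCountable ν.law

instance (ν : BanditInstance K) : IsMarkovKernel ν.rewardKernel := ⟨ν.isProbabilityMeasure⟩

end BanditInstance

/-- The centred unit-variance Gaussian distribution is `1`-sub-Gaussian. -/
theorem hasSubgaussianMGF_gaussianReal (m : ℝ) :
    HasSubgaussianMGF (fun x : ℝ => x - ∫ y, y ∂(gaussianReal m 1)) 1 (gaussianReal m 1) := by
  have h : (gaussianReal m 1).map (fun x : ℝ => x - ∫ y, y ∂(gaussianReal m 1))
      = gaussianReal 0 1 := by
    rw [integral_id_gaussianReal, gaussianReal_map_sub_const, sub_self]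
  have hmeas : Measurable (fun x : ℝ => x - ∫ y, y ∂(gaussianReal m 1)) := by fun_prop
  refine ⟨fun t => ?_, fun t => ?_⟩
  · have h1 : Integrable (fun x : ℝ => Real.exp (t * x))
        ((gaussianReal m 1).map (fun x : ℝ => x - ∫ y, y ∂(gaussianReal m 1))) := by
      rw [h]
      exact integrable_exp_mul_gaussianReal t
    exact h1.comp_measurable hmeas
  · rw [mgf_gaussianReal h t]
    simp

/-- The instance in which arm `a` has reward distribution `N(μ a, 1)`. -/
noncomputable def gaussianInstance {K : ℕ} (μ : Fin K → ℝ) : BanditInstance K where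
  law a := gaussianReal (μ a) 1
  isProbabilityMeasure _ := inferInstance
  subGaussian a := hasSubgaussianMGF_gaussianReal (μ a)

/-- The mean reward vector of `gaussianInstance μ` is `μ`. -/
theorem mean_gaussianInstance {K : ℕ} (μ : Fin K → ℝ) (a : Fin K) :
    (gaussianInstance μ).mean a = μ a :=
  integral_id_gaussianReal

/-- An infinite record of the pairs (arm pulled, reward received). The entry with index `t` belongs
to round `t + 1`. -/
abbrev Trajectory (K : ℕ) : Type := ℕ → Fin K × ℝ

/-- The `σ`-algebra at time `t` is generated by the first `t` rounds (the entries with index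
`< t`). -/
def historyFiltration (K : ℕ) :
    Filtration ℕ (inferInstance : MeasurableSpace (Trajectory K)) where
  seq t := Filtration.piFinset (X := fun _ : ℕ => Fin K × ℝ) (Finset.range t)
  mono' _ _ hst := Filtration.piFinset.mono (Finset.range_mono hst)
  le' t := Filtration.piFinset.le (Finset.range t)

/-- A pulling strategy: a (possibly randomised) sampling rule, which gives the distribution of the
first arm and of the arm of round `t + 2` given the history of rounds `1, …, t + 1`; a stopping
time `stopTime` for the history, counting the rounds played (`⊤` means that the strategy never stops);
and a recommendation determined by the history at the stopping time. -/
structure PullingStrategy (K : ℕ) where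
  sampleFirst : Measure (Fin K)
  isProbabilityMeasure_sampleFirst : IsProbabilityMeasure sampleFirst
  sampleNext : ∀ t : ℕ, Kernel ((i : Finset.Iic t) → Fin K × ℝ) (Fin K)
  isMarkovKernel_sampleNext : ∀ t, IsMarkovKernel (sampleNext t)
  stopTime : Trajectory K → ℕ∞
  isStoppingTime_stopTime : IsStoppingTime (historyFiltration K) stopTime
  recommend : Trajectory K → Option (Fin K)
  measurableSet_recommend :
    ∀ o, MeasurableSet[isStoppingTime_stopTime.measurableSpace] (recommend ⁻¹' {o})

namespace PullingStrategy

variable {K : ℕ}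

instance (s : PullingStrategy K) : IsProbabilityMeasure s.sampleFirst :=
  s.isProbabilityMeasure_sampleFirst

instance (s : PullingStrategy K) (t : ℕ) : IsMarkovKernel (s.sampleNext t) :=
  s.isMarkovKernel_sampleNext t

/-- Given the history of rounds `1, …, t + 1`, the joint distribution of the arm and the reward of
round `t + 2`: the arm follows the sampling rule and the reward follows the law of that arm. -/
noncomputable def stepKernel (s : PullingStrategy K) (ν : BanditInstance K) (t : ℕ) :
    Kernel ((i : Finset.Iic t) → Fin K × ℝ) (Fin K × ℝ) :=
  s.sampleNext t ⊗ₖ Kernel.prodMkLeft _ ν.rewardKernel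

instance (s : PullingStrategy K) (ν : BanditInstance K) (t : ℕ) :
    IsMarkovKernel (s.stepKernel ν t) := by
  unfold stepKernel
  infer_instance

/-- The distribution of the trajectory when the sampling rule of `s` is run forever on `ν`. Events
and quantities that only involve the rounds up to the stopping time are read off from it. -/
noncomputable def trajectoryLaw (s : PullingStrategy K) (ν : BanditInstance K) :
    Measure (Trajectory K) :=
  Kernel.trajMeasure (X := fun _ : ℕ => Fin K × ℝ)
    (s.sampleFirst ⊗ₘ ν.rewardKernel) (s.stepKernel ν)

/-- `N_a(τ)`, the number of pulls of arm `a` up to the stopping time. -/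
noncomputable def pullCount (s : PullingStrategy K) (a : Fin K) (ω : Trajectory K) : ℕ∞ :=
  {t : ℕ | (t : ℕ∞) < s.stopTime ω ∧ (ω t).1 = a}.encard

/-- `E_ν[N_a(τ)]`. -/
noncomputable def expectedPullCount (s : PullingStrategy K) (ν : BanditInstance K) (a : Fin K) :
    ℝ≥0∞ :=
  ∫⁻ ω, (s.pullCount a ω : ℝ≥0∞) ∂(s.trajectoryLaw ν)

/-- `E_ν[τ]`. -/
noncomputable def expectedStop (s : PullingStrategy K) (ν : BanditInstance K) : ℝ≥0∞ :=
  ∫⁻ ω, (s.stopTime ω : ℝ≥0∞) ∂(s.trajectoryLaw ν)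

/-- The strategy is `δ`-PAC for the threshold `μ₀`: on every positive and every negative instance
it stops and gives a correct answer with probability larger than `1 - δ`. -/
def IsDeltaPAC (s : PullingStrategy K) (μ₀ δ : ℝ) : Prop :=
  ∀ ν : BanditInstance K, ν.IsPositive μ₀ ∨ ν.IsNegative μ₀ →
    1 - δ < (s.trajectoryLaw ν).real {ω | s.stopTime ω < ⊤ ∧ s.recommend ω ∈ ν.correctAnswers μ₀}

/-- The strategy is `(Δ, δ)`-PAC for the threshold `μ₀`: it is `δ`-PAC, and for every `Δ > 0` its
expected stopping time is bounded uniformly over the instances with gap at least `Δ`. -/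
def IsGapDeltaPAC (s : PullingStrategy K) (μ₀ δ : ℝ) : Prop :=
  s.IsDeltaPAC μ₀ δ ∧
    ∀ Δ : ℝ, 0 < Δ →
      (⨆ ν ∈ {ν : BanditInstance K | ν.IsPositiveWithGap μ₀ Δ ∨ ν.IsNegativeWithGap μ₀ Δ},
        s.expectedStop ν) < ⊤

end PullingStrategy

end OneIdentification

/-! Write Δ = μ₁ - μ₀ and let n be about 1/Δ². Two reflections of a mean about μ₀ give the bound.

Reflecting the best arm to μ₀ - Δ makes the instance negative, and n rounds can barely tell the two
instances apart. A strategy that rarely errs on the negative one therefore seldom stops by time n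
with the best arm, so it plays more than n rounds on ν with probability at least 3/4
(`three_quarters_le_trajectoryLaw_lt_stopTime`).

Reflecting a bad arm a to 2μ₀ - μ_a gives a positive instance whose gap does not depend on μ₁. Its
expected stopping time is at most some fixed T, so by Markov's inequality it is still running at
time n with probability at most T/n, of order Δ². On ν this event has probability at least 3/4. Only
pulls of a distinguish the two instances, so going from order Δ² to a constant takes about
log(1/Δ²)/(μ₀ - μ_a)² of them.

Both comparisons rest on P(A)² ≤ exp(c) P'(A), valid if the squared mean differences of the pulled
arms sum to at most c on A (`sq_trajectoryLaw_real_le`). It follows from Cauchy–Schwarz applied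
round by round, without a likelihood ratio for whole trajectories. -/

namespace OneIdentification

/-! ### Second-moment change of measure for one Gaussian reward -/

/-- The Cauchy–Schwarz inequality for the Lebesgue integral of `ℝ≥0∞`-valued functions. -/
theorem sq_lintegral_mul_le {α : Type*} [MeasurableSpace α] (μ : Measure α) {f g : α → ℝ≥0∞}
    (hf : Measurable f) (hg : Measurable g) :
    (∫⁻ x, f x * g x ∂μ) ^ 2 ≤ (∫⁻ x, f x ^ 2 ∂μ) * ∫⁻ x, g x ^ 2 ∂μ := by
  have h := ENNReal.lintegral_mul_le_Lp_mul_Lq μ Real.HolderConjugate.two_two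
    hf.aemeasurable hg.aemeasurable
  simp only [Pi.mul_apply, ENNReal.rpow_two] at h
  have hs : ∀ x : ℝ≥0∞, (x ^ (1 / 2 : ℝ)) ^ 2 = x := fun x => by
    rw [← ENNReal.rpow_natCast, ← ENNReal.rpow_mul]
    norm_num
  calc (∫⁻ x, f x * g x ∂μ) ^ 2
      ≤ ((∫⁻ x, f x ^ 2 ∂μ) ^ (1 / 2 : ℝ) * (∫⁻ x, g x ^ 2 ∂μ) ^ (1 / 2 : ℝ)) ^ 2 := by gcongr
    _ = _ := by rw [mul_pow, hs, hs]

/-- The square of the mean is at most the mean of the square. -/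
theorem sq_lintegral_le {α : Type*} [MeasurableSpace α] (μ : Measure α) [IsProbabilityMeasure μ]
    {f : α → ℝ≥0∞} (hf : Measurable f) : (∫⁻ x, f x ∂μ) ^ 2 ≤ ∫⁻ x, f x ^ 2 ∂μ := by
  simpa using sq_lintegral_mul_le μ hf (measurable_const (a := (1 : ℝ≥0∞)))

/-- A change of mean for unit-variance Gaussian distributions: the second moment of the likelihood
ratio of `N(m, 1)` with respect to `N(m', 1)` is `exp ((m - m') ^ 2)`. -/
theorem sq_lintegral_gaussianReal_le (m m' : ℝ) {f : ℝ → ℝ≥0∞} (hf : Measurable f) :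
    (∫⁻ x, f x ∂(gaussianReal m 1)) ^ 2 ≤
      ENNReal.ofReal (Real.exp ((m - m') ^ 2)) * ∫⁻ x, f x ^ 2 ∂(gaussianReal m' 1) := by
  have hr : Measurable fun x : ℝ =>
      ENNReal.ofReal (Real.exp ((m - m') * (x - m') - (m - m') ^ 2 / 2)) := by fun_prop
  have hd : ∀ x, gaussianPDF m 1 x =
      gaussianPDF m' 1 x * ENNReal.ofReal (Real.exp ((m - m') * (x - m') - (m - m') ^ 2 / 2)) := by
    intro x
    simp only [gaussianPDF, gaussianPDFReal]
    rw [← ENNReal.ofReal_mul (by positivity), mul_assoc (_)⁻¹, ← Real.exp_add]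
    congr 3
    push_cast
    ring
  -- Completing the square: the squared likelihood ratio times the N(m', 1) density is a constant
  -- times the N(2m - m', 1) density, which has mass one.
  have hd2 : ∀ x, gaussianPDF m' 1 x *
      ENNReal.ofReal (Real.exp ((m - m') * (x - m') - (m - m') ^ 2 / 2)) ^ 2 =
      ENNReal.ofReal (Real.exp ((m - m') ^ 2)) * gaussianPDF (2 * m - m') 1 x := by
    intro x
    simp only [gaussianPDF, gaussianPDFReal]
    rw [← ENNReal.ofReal_pow (by positivity), ← ENNReal.ofReal_mul (by positivity),
      ← ENNReal.ofReal_mul (by positivity), ← Real.exp_nat_mul, mul_assoc (_)⁻¹,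
      mul_left_comm (Real.exp _) (_)⁻¹, ← Real.exp_add, ← Real.exp_add]
    congr 3
    push_cast
    ring
  have hfr : Measurable fun x => f x *
      ENNReal.ofReal (Real.exp ((m - m') * (x - m') - (m - m') ^ 2 / 2)) := hf.mul hr
  have h1 : ∫⁻ x, f x ∂(gaussianReal m 1) = ∫⁻ x, f x *
      ENNReal.ofReal (Real.exp ((m - m') * (x - m') - (m - m') ^ 2 / 2))
        ∂(gaussianReal m' 1) := by
    rw [gaussianReal_of_var_ne_zero _ one_ne_zero, gaussianReal_of_var_ne_zero _ one_ne_zero,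
      lintegral_withDensity_eq_lintegral_mul _ (measurable_gaussianPDF _ _) hf,
      lintegral_withDensity_eq_lintegral_mul _ (measurable_gaussianPDF _ _) hfr]
    refine lintegral_congr fun x => ?_
    simp only [Pi.mul_apply]
    rw [hd, mul_assoc, mul_comm (f x)]
  have h2 : ∫⁻ x, ENNReal.ofReal (Real.exp ((m - m') * (x - m') - (m - m') ^ 2 / 2)) ^ 2
      ∂(gaussianReal m' 1) = ENNReal.ofReal (Real.exp ((m - m') ^ 2)) := by
    rw [gaussianReal_of_var_ne_zero _ one_ne_zero,
      lintegral_withDensity_eq_lintegral_mul _ (measurable_gaussianPDF _ _) (hr.pow_const 2)]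
    simp only [Pi.mul_apply, hd2]
    rw [lintegral_const_mul _ (measurable_gaussianPDF _ _),
      lintegral_gaussianPDF_eq_one _ one_ne_zero, mul_one]
  rw [h1, ← h2, mul_comm]
  exact sq_lintegral_mul_le _ hf hr

/-! ### Integration along a trajectory, one round at a time -/

/-- The integral of a function of the first `n + 2` rounds, computed by conditioning on the first
`n + 1` rounds. -/
theorem lintegral_trajMeasure_of_dependsOn {X : Type*} [MeasurableSpace X]
    (μ₀ : Measure X) [IsProbabilityMeasure μ₀]
    (κ : (n : ℕ) → Kernel ((i : Finset.Iic n) → X) X) [∀ n, IsMarkovKernel (κ n)]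
    (n : ℕ) {f : (ℕ → X) → ℝ≥0∞} (hf : Measurable f) (hd : DependsOn f (Set.Iic (n + 1))) :
    ∫⁻ ω, f ω ∂(Kernel.trajMeasure (X := fun _ => X) μ₀ κ) =
      ∫⁻ ω, ∫⁻ x, f (Function.update ω (n + 1) x) ∂(κ n (Preorder.frestrictLe n ω))
        ∂(Kernel.trajMeasure (X := fun _ => X) μ₀ κ) := by
  classical
  -- Extends a history and one new entry to a full trajectory. Repeating the new entry beyond index
  -- n + 1 is harmless, since f ignores those indices.
  let e : ((i : Finset.Iic n) → X) × X → ℕ → X := fun p t =>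
    if h : t ≤ n then p.1 ⟨t, Finset.mem_Iic.2 h⟩ else p.2
  have he : Measurable e := by
    refine measurable_pi_lambda _ fun t => ?_
    by_cases h : t ≤ n
    · simp only [e, h, dite_true]; fun_prop
    · simp only [e, h, dite_false]; fun_prop
  have h1 : ∀ ω x, f (e (Preorder.frestrictLe n ω, x)) = f (Function.update ω (n + 1) x) := by
    intro ω x
    refine hd fun t ht => ?_
    by_cases h : t ≤ n
    · simp [e, h, Function.update_of_ne (show t ≠ n + 1 by omega)]
    · obtain rfl : t = n + 1 := by simp at ht; omega
      simp [e]
  have h2 := Kernel.map_frestrictLe_trajMeasure_compProd_eq_map_trajMeasure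
    (X := fun _ => X) (μ₀ := μ₀) (κ := κ) (a := n)
  have hfe : Measurable fun p => f (e p) := hf.comp he
  have hm : Measurable fun ω : ℕ → X =>
      (Preorder.frestrictLe (π := fun _ => X) n ω, ω (n + 1)) := by fun_prop
  calc ∫⁻ ω, f ω ∂(Kernel.trajMeasure (X := fun _ => X) μ₀ κ)
      = ∫⁻ ω, f (e (Preorder.frestrictLe (π := fun _ => X) n ω, ω (n + 1)))
          ∂(Kernel.trajMeasure (X := fun _ => X) μ₀ κ) := by simp [h1]
    _ = ∫⁻ p, f (e p) ∂((Kernel.trajMeasure (X := fun _ => X) μ₀ κ).map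
          fun ω => (Preorder.frestrictLe (π := fun _ => X) n ω, ω (n + 1))) :=
        (lintegral_map hfe hm).symm
    _ = _ := by
      rw [← h2, Measure.lintegral_compProd hfe, lintegral_map _ (by fun_prop)]
      · simp [h1]
      · exact hfe.lintegral_kernel_prod_right'

/-- The integral of a function of the first round. -/
theorem lintegral_trajMeasure_of_dependsOn_zero {X : Type*} [MeasurableSpace X]
    (μ₀ : Measure X) [IsProbabilityMeasure μ₀]
    (κ : (n : ℕ) → Kernel ((i : Finset.Iic n) → X) X) [∀ n, IsMarkovKernel (κ n)]
    {f : (ℕ → X) → ℝ≥0∞} (hf : Measurable f) (hd : DependsOn f (Set.Iic 0)) :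
    ∫⁻ ω, f ω ∂(Kernel.trajMeasure (X := fun _ => X) μ₀ κ) = ∫⁻ x, f (fun _ => x) ∂μ₀ := by
  have h0 : (Kernel.trajMeasure (X := fun _ => X) μ₀ κ).map (Preorder.frestrictLe 0) =
      μ₀.map (MeasurableEquiv.piUnique (fun _ : Finset.Iic 0 => X)).symm := by
    rw [Kernel.trajMeasure, Measure.map_comp _ _ (by fun_prop), Kernel.traj_map_frestrictLe,
      Kernel.partialTraj_self]
    exact Measure.id_comp
  let e : ((i : Finset.Iic 0) → X) → ℕ → X := fun h _ => h ⟨0, by simp⟩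
  have he : Measurable e := by fun_prop
  have hfe : Measurable fun p => f (e p) := hf.comp he
  calc ∫⁻ ω, f ω ∂(Kernel.trajMeasure (X := fun _ => X) μ₀ κ)
      = ∫⁻ ω, f (e (Preorder.frestrictLe (π := fun _ => X) 0 ω))
          ∂(Kernel.trajMeasure (X := fun _ => X) μ₀ κ) := by
        refine lintegral_congr fun ω => hd fun t ht => ?_
        obtain rfl : t = 0 := by simpa using ht
        rfl
    _ = ∫⁻ p, f (e p) ∂((Kernel.trajMeasure (X := fun _ => X) μ₀ κ).map
          (Preorder.frestrictLe 0)) := (lintegral_map hfe (by fun_prop)).symm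
    _ = _ := by
      rw [h0, lintegral_map hfe (MeasurableEquiv.measurable _)]
      rfl

/-! ### Change of measure for the trajectories of a strategy -/

variable {K : ℕ}

/-- The second moment of the likelihood ratio of one pull of the arm `a`, for two Gaussian
instances with mean rewards `μ` and `μ'`. -/
noncomputable def pullWeight (μ μ' : Fin K → ℝ) (a : Fin K) : ℝ≥0∞ :=
  ENNReal.ofReal (Real.exp ((μ a - μ' a) ^ 2))

/-- The arm has the same law π under both instances, so averaging over it costs only Jensen's
inequality. The Gaussian bound is then applied arm by arm, and the weight stays inside the integral
because it depends on the arm. -/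
theorem sq_lintegral_compProd_rewardKernel_le (μ μ' : Fin K → ℝ) (π : Measure (Fin K))
    [IsProbabilityMeasure π] {f : Fin K × ℝ → ℝ≥0∞} (hf : Measurable f) :
    (∫⁻ x, f x ∂(π ⊗ₘ (gaussianInstance μ).rewardKernel)) ^ 2 ≤
      ∫⁻ x, f x ^ 2 * pullWeight μ μ' x.1 ∂(π ⊗ₘ (gaussianInstance μ').rewardKernel) := by
  have hw : Measurable fun x : Fin K × ℝ => pullWeight μ μ' x.1 :=
    (measurable_of_finite (pullWeight μ μ')).comp measurable_fst
  have hfw : Measurable fun x => f x ^ 2 * pullWeight μ μ' x.1 := (hf.pow_const 2).mul hw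
  rw [Measure.lintegral_compProd hf, Measure.lintegral_compProd hfw]
  refine (sq_lintegral_le π (measurable_of_finite _)).trans (lintegral_mono fun a => ?_)
  have hfa : Measurable fun x => f (a, x) := by fun_prop
  dsimp only
  rw [lintegral_mul_const _ (hfa.pow_const 2), mul_comm]
  exact sq_lintegral_gaussianReal_le (μ a) (μ' a) hfa

theorem stepKernel_apply (s : PullingStrategy K) (ν : BanditInstance K) (n : ℕ)
    (h : (i : Finset.Iic n) → Fin K × ℝ) :
    s.stepKernel ν n h = s.sampleNext n h ⊗ₘ ν.rewardKernel := by
  rw [PullingStrategy.stepKernel, Kernel.compProd_apply_eq_compProd_sectR, Kernel.sectR_prodMkLeft]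

/-- The second moment of the likelihood ratio of the first `n + 1` rounds bounds the change of the
integral of a function of these rounds between two Gaussian instances. -/
theorem sq_lintegral_trajectoryLaw_le (s : PullingStrategy K) (μ μ' : Fin K → ℝ) (n : ℕ)
    {f : Trajectory K → ℝ≥0∞} (hf : Measurable f) (hd : DependsOn f (Set.Iic n)) :
    (∫⁻ ω, f ω ∂(s.trajectoryLaw (gaussianInstance μ))) ^ 2 ≤
      ∫⁻ ω, f ω ^ 2 * ∏ t ∈ Finset.range (n + 1), pullWeight μ μ' (ω t).1
        ∂(s.trajectoryLaw (gaussianInstance μ')) := by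
  have hw : ∀ t : ℕ, Measurable fun ω : Trajectory K => pullWeight μ μ' (ω t).1 := fun t =>
    (measurable_of_finite (pullWeight μ μ')).comp (by fun_prop)
  have hW : ∀ n : ℕ, Measurable fun ω : Trajectory K =>
      ∏ t ∈ Finset.range (n + 1), pullWeight μ μ' (ω t).1 := fun n =>
    Finset.measurable_fun_prod _ fun t _ => hw t
  have hfW : ∀ (n : ℕ) {f : Trajectory K → ℝ≥0∞}, Measurable f →
      Measurable fun ω => f ω ^ 2 * ∏ t ∈ Finset.range (n + 1), pullWeight μ μ' (ω t).1 :=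
    fun n f hf => (hf.pow_const 2).mul (hW n)
  have hdW : ∀ (n : ℕ) {f : Trajectory K → ℝ≥0∞}, DependsOn f (Set.Iic n) →
      DependsOn (fun ω => f ω ^ 2 * ∏ t ∈ Finset.range (n + 1), pullWeight μ μ' (ω t).1)
        (Set.Iic n) := by
    intro n f hd ω ω' h
    dsimp only
    rw [hd h, Finset.prod_congr rfl fun t ht => ?_]
    rw [h t (by simp at ht ⊢; omega)]
  induction n generalizing f with
  | zero =>
    unfold PullingStrategy.trajectoryLaw
    rw [lintegral_trajMeasure_of_dependsOn_zero _ _ hf hd,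
      lintegral_trajMeasure_of_dependsOn_zero _ _ (hfW 0 hf) (hdW 0 hd)]
    simpa using sq_lintegral_compProd_rewardKernel_le μ μ' s.sampleFirst
      (f := fun x => f fun _ => x) (by fun_prop)
  | succ n ih =>
    -- The conditional expectation of f, under μ, given the first n + 1 rounds. The induction
    -- hypothesis handles g, and the one-round bound handles g ^ 2.
    let g : Trajectory K → ℝ≥0∞ := fun ω =>
      ∫⁻ x, f (Function.update ω (n + 1) x)
        ∂(s.stepKernel (gaussianInstance μ) n (Preorder.frestrictLe n ω))
    have hu : Measurable fun p : Trajectory K × (Fin K × ℝ) =>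
        Function.update p.1 (n + 1) p.2 := by
      refine measurable_pi_lambda _ fun t => ?_
      by_cases h : t = n + 1
      · subst h; simpa using measurable_snd
      · simp only [Function.update_of_ne h]; fun_prop
    have hg : Measurable g := by
      have := (hf.comp hu).lintegral_kernel_prod_right'
        (κ := (s.stepKernel (gaussianInstance μ) n).comap
          (Preorder.frestrictLe (π := fun _ => Fin K × ℝ) n) (by fun_prop))
      simpa [g, Kernel.comap_apply] using this
    have hgd : DependsOn g (Set.Iic n) := by
      intro ω ω' h
      have h1 : Preorder.frestrictLe (π := fun _ => Fin K × ℝ) n ω =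
          Preorder.frestrictLe n ω' := by
        ext1 i
        exact h i (Finset.mem_Iic.1 i.2)
      simp only [g, h1]
      refine lintegral_congr fun x => hd fun t ht => ?_
      by_cases ht' : t = n + 1
      · subst ht'; simp
      · simp only [Function.update_of_ne ht']
        exact h t (by simp at ht ⊢; omega)
    have h1 : ∫⁻ ω, f ω ∂(s.trajectoryLaw (gaussianInstance μ)) =
        ∫⁻ ω, g ω ∂(s.trajectoryLaw (gaussianInstance μ)) :=
      lintegral_trajMeasure_of_dependsOn _ _ n hf hd
    rw [h1]
    refine (ih hg hgd).trans ?_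
    unfold PullingStrategy.trajectoryLaw
    rw [lintegral_trajMeasure_of_dependsOn _ _ n (hfW (n + 1) hf)
      (hdW (n + 1) hd)]
    refine lintegral_mono fun ω => ?_
    have h2 : ∀ x, ∏ t ∈ Finset.range (n + 1 + 1),
        pullWeight μ μ' (Function.update ω (n + 1) x t).1 =
          pullWeight μ μ' x.1 * ∏ t ∈ Finset.range (n + 1), pullWeight μ μ' (ω t).1 := by
      intro x
      rw [Finset.prod_range_succ, Function.update_self, mul_comm]
      congr 1
      refine Finset.prod_congr rfl fun t ht => ?_
      rw [Function.update_of_ne (by simp at ht; omega)]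
    have hfx : Measurable fun x => f (Function.update ω (n + 1) x) :=
      hf.comp (hu.comp measurable_prodMk_left)
    have hwx : Measurable fun x : Fin K × ℝ => pullWeight μ μ' x.1 :=
      (measurable_of_finite (pullWeight μ μ')).comp measurable_fst
    have hfwx : Measurable fun x =>
        f (Function.update ω (n + 1) x) ^ 2 * pullWeight μ μ' x.1 := (hfx.pow_const 2).mul hwx
    simp only [h2, ← mul_assoc]
    rw [lintegral_mul_const _ hfwx]
    gcongr
    simp only [g, stepKernel_apply]
    exact sq_lintegral_compProd_rewardKernel_le μ μ' _ hfx

/-- A change of measure for an event of the first `n + 1` rounds on which the second moment of the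
likelihood ratio is at most `C`. -/
theorem sq_trajectoryLaw_le (s : PullingStrategy K) (μ μ' : Fin K → ℝ) (n : ℕ)
    {A : Set (Trajectory K)} (hA : MeasurableSet[historyFiltration K (n + 1)] A) {C : ℝ≥0∞}
    (hC : ∀ ω ∈ A, ∏ t ∈ Finset.range (n + 1), pullWeight μ μ' (ω t).1 ≤ C) :
    s.trajectoryLaw (gaussianInstance μ) A ^ 2 ≤
      C * s.trajectoryLaw (gaussianInstance μ') A := by
  have hA' : MeasurableSet A := (historyFiltration K).le (n + 1) A hA
  have hd : DependsOn (A.indicator (1 : Trajectory K → ℝ≥0∞)) (Set.Iic n) := by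
    have hm : Measurable[Filtration.piFinset (X := fun _ : ℕ => Fin K × ℝ) (Finset.range (n + 1))]
        (A.indicator (1 : Trajectory K → ℝ≥0∞)) := Measurable.indicator measurable_const hA
    have h := hm.dependsOn_of_piFinset
    convert h using 1
    ext t
    simp
  have h := sq_lintegral_trajectoryLaw_le s μ μ' n (measurable_one.indicator hA') hd
  rw [lintegral_indicator_one hA'] at h
  refine h.trans ?_
  rw [← lintegral_indicator_one hA', ← lintegral_const_mul _ (measurable_one.indicator hA')]
  refine lintegral_mono fun ω => ?_
  by_cases hω : ω ∈ A
  · simpa [hω] using hC ω hω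
  · simp [hω]

instance (s : PullingStrategy K) (ν : BanditInstance K) :
    IsProbabilityMeasure (s.trajectoryLaw ν) := by
  unfold PullingStrategy.trajectoryLaw
  infer_instance

/-- A change of measure for an event of the first `n` rounds on which the sum of the squared
differences of the means of the pulled arms is at most `c`. -/
theorem sq_trajectoryLaw_real_le (s : PullingStrategy K) (μ μ' : Fin K → ℝ) {n : ℕ} (hn : 0 < n)
    {A : Set (Trajectory K)} (hA : MeasurableSet[historyFiltration K n] A) {c : ℝ}
    (hc : ∀ ω ∈ A, ∑ t ∈ Finset.range n, (μ (ω t).1 - μ' (ω t).1) ^ 2 ≤ c) :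
    (s.trajectoryLaw (gaussianInstance μ)).real A ^ 2 ≤
      Real.exp c * (s.trajectoryLaw (gaussianInstance μ')).real A := by
  obtain ⟨n, rfl⟩ : ∃ k, n = k + 1 := ⟨n - 1, by omega⟩
  have h := sq_trajectoryLaw_le s μ μ' n hA (C := ENNReal.ofReal (Real.exp c)) fun ω hω => by
    simp only [pullWeight]
    rw [← ENNReal.ofReal_prod_of_nonneg fun _ _ => (Real.exp_pos _).le, ← Real.exp_sum]
    exact ENNReal.ofReal_le_ofReal (Real.exp_le_exp.2 (hc ω hω))
  have h' := ENNReal.toReal_mono (by finiteness) h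
  rwa [ENNReal.toReal_pow, ENNReal.toReal_mul, ENNReal.toReal_ofReal (Real.exp_pos _).le] at h'

/-! ### Pull counts and stopping times -/

/-- The number of pulls of arm `a` in the first `n` rounds. -/
def pullsBefore (a : Fin K) (n : ℕ) (ω : Trajectory K) : ℕ :=
  ((Finset.range n).filter fun t => (ω t).1 = a).card

theorem measurable_pullsBefore (a : Fin K) (n : ℕ) :
    Measurable[historyFiltration K n] (pullsBefore a n) := by
  have h : Measurable fun h : (i : Finset.range n) → Fin K × ℝ =>
      ∑ t : Finset.range n, if (h t).1 = a then 1 else 0 :=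
    Finset.measurable_fun_sum _ fun t _ =>
      (measurable_of_finite fun b : Fin K => if b = a then 1 else 0).comp (by fun_prop)
  have hr : Measurable[historyFiltration K n]
      ((Finset.range n).restrict (π := fun _ : ℕ => Fin K × ℝ)) :=
    comap_measurable _
  convert h.comp hr using 1
  ext ω
  simp only [pullsBefore, Finset.card_filter, Function.comp_apply, Finset.restrict]
  exact (Finset.sum_coe_sort (Finset.range n) fun t => if (ω t).1 = a then 1 else 0).symm

theorem measurableSet_stopTime_le (s : PullingStrategy K) (n : ℕ) :
    MeasurableSet[historyFiltration K n] {ω | s.stopTime ω ≤ n} :=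
  s.isStoppingTime_stopTime n

theorem measurableSet_lt_stopTime (s : PullingStrategy K) (n : ℕ) :
    MeasurableSet[historyFiltration K n] {ω | (n : ℕ∞) < s.stopTime ω} := by
  convert (measurableSet_stopTime_le s n).compl using 1
  ext ω
  simp

theorem pullsBefore_le_pullCount (s : PullingStrategy K) (a : Fin K) {n : ℕ} {ω : Trajectory K}
    (h : (n : ℕ∞) < s.stopTime ω) : (pullsBefore a n ω : ℕ∞) ≤ s.pullCount a ω := by
  rw [pullsBefore, ← Set.encard_coe_eq_coe_finsetCard, PullingStrategy.pullCount]
  refine Set.encard_le_encard fun t ht => ?_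
  simp only [Finset.coe_filter, Finset.mem_range, Set.mem_ofPred_eq] at ht ⊢
  exact ⟨lt_trans (by exact_mod_cast ht.1) h, ht.2⟩

/-- Markov's inequality for the stopping time. -/
theorem mul_trajectoryLaw_lt_stopTime_le (s : PullingStrategy K) (ν : BanditInstance K) {T : ℝ}
    (hT : s.expectedStop ν ≤ ENNReal.ofReal T) (hT0 : 0 ≤ T) (n : ℕ) :
    n * (s.trajectoryLaw ν).real {ω | (n : ℕ∞) < s.stopTime ω} ≤ T := by
  have hm : MeasurableSet {ω | (n : ℕ∞) < s.stopTime ω} :=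
    (historyFiltration K).le n _ (measurableSet_lt_stopTime s n)
  have h : (n : ℝ≥0∞) * s.trajectoryLaw ν {ω | (n : ℕ∞) < s.stopTime ω} ≤ ENNReal.ofReal T := by
    rw [← setLIntegral_const]
    refine (setLIntegral_mono' hm fun ω hω => ?_).trans
      ((setLIntegral_le_lintegral _ fun ω => (s.stopTime ω : ℝ≥0∞)).trans hT)
    simpa using ENat.toENNReal_le.2 (le_of_lt hω)
  have h' := ENNReal.toReal_mono ENNReal.ofReal_ne_top h
  rwa [ENNReal.toReal_mul, ENNReal.toReal_ofReal hT0, ENNReal.toReal_natCast] at h'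

/-- A lower bound for the expected number of pulls from the probability of many pulls. -/
theorem ofReal_mul_le_expectedPullCount (s : PullingStrategy K) (ν : BanditInstance K) (a : Fin K)
    (n : ℕ) {k p : ℝ} (hp : p ≤ (s.trajectoryLaw ν).real
      {ω | (n : ℕ∞) < s.stopTime ω ∧ k < pullsBefore a n ω}) (hk : 0 ≤ k) :
    ENNReal.ofReal (k * p) ≤ s.expectedPullCount ν a := by
  have hm : MeasurableSet {ω | (n : ℕ∞) < s.stopTime ω ∧ k < pullsBefore a n ω} := by
    have h : Measurable (pullsBefore a n) :=
      (measurable_pullsBefore a n).mono ((historyFiltration K).le n) le_rfl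
    refine ((historyFiltration K).le n _ (measurableSet_lt_stopTime s n)).inter ?_
    exact h (measurableSet_lt (g := fun i : ℕ => (i : ℝ)) measurable_const measurable_from_nat)
  calc ENNReal.ofReal (k * p)
      ≤ ENNReal.ofReal k * s.trajectoryLaw ν
          {ω | (n : ℕ∞) < s.stopTime ω ∧ k < pullsBefore a n ω} := by
        rw [ENNReal.ofReal_mul hk]
        gcongr
        exact ENNReal.ofReal_le_of_le_toReal hp
    _ ≤ s.expectedPullCount ν a := by
        rw [← setLIntegral_const]
        refine (setLIntegral_mono' hm fun ω hω => ?_).trans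
          (setLIntegral_le_lintegral _ fun ω => (s.pullCount a ω : ℝ≥0∞))
        calc ENNReal.ofReal k ≤ ENNReal.ofReal (pullsBefore a n ω : ℝ) :=
              ENNReal.ofReal_le_ofReal hω.2.le
          _ = ((pullsBefore a n ω : ℕ∞) : ℝ≥0∞) := by simp
          _ ≤ _ := ENat.toENNReal_le.2 (pullsBefore_le_pullCount s a hω.1)

/-! ### The two reflections -/

/-- With probability at least `3 / 4`, a `δ`-PAC strategy plays more than `n` rounds on an instance
whose only correct answer is an arm of gap at most `1 / √n`. -/
theorem three_quarters_le_trajectoryLaw_lt_stopTime {m : ℕ} {μ₀ δ : ℝ} {μ : Fin m → ℝ}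
    (hμ : ∀ a, μ a < μ₀) (hδ : δ < Real.exp (-8)) {s : PullingStrategy (m + 1)}
    (hs : s.IsDeltaPAC μ₀ δ) {μ₁ : ℝ} (h₁ : μ₀ < μ₁) {n : ℕ} (hn : 0 < n)
    (hn' : n * (μ₁ - μ₀) ^ 2 ≤ 1) :
    3 / 4 ≤ (s.trajectoryLaw (gaussianInstance (Fin.cons μ₁ μ))).real
      {ω | (n : ℕ∞) < s.stopTime ω} := by
  set ν := gaussianInstance (Fin.cons μ₁ μ : Fin (m + 1) → ℝ) with hν
  set ν' := gaussianInstance (Fin.cons (2 * μ₀ - μ₁) μ : Fin (m + 1) → ℝ) with hν'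
  -- On ν the correct answer is arm 0 alone, so a correct run lies in G or lasts beyond n. On ν'
  -- every run in G is wrong.
  let G : Set (Trajectory (m + 1)) := s.recommend ⁻¹' {some 0} ∩ {ω | s.stopTime ω ≤ n}
  have hG : MeasurableSet[historyFiltration (m + 1) n] G :=
    (s.measurableSet_recommend (some 0)).2 n
  have hneg : ∀ a, ν'.mean a < μ₀ := by
    intro a
    rw [hν', mean_gaussianInstance]
    refine Fin.cases ?_ (fun a => ?_) a
    · simp only [Fin.cons_zero]; linarith
    · simpa using hμ a
  have h1 : 1 - δ < (s.trajectoryLaw ν).real G +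
      (s.trajectoryLaw ν).real {ω | (n : ℕ∞) < s.stopTime ω} := by
    refine (hs ν (Or.inl ⟨0, by simpa [hν, mean_gaussianInstance] using h₁⟩)).trans_le
      ((measureReal_mono ?_).trans (measureReal_union_le _ _))
    rintro ω ⟨-, (⟨-, a, ha, hle⟩ | ⟨hn, -⟩)⟩
    · by_cases hω : (n : ℕ∞) < s.stopTime ω
      · exact Or.inr hω
      · refine Or.inl ⟨?_, not_lt.1 hω⟩
        revert ha hle
        refine Fin.cases (fun ha _ => ha) (fun a _ hle => ?_) a
        rw [hν, mean_gaussianInstance, Fin.cons_succ] at hle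
        exact absurd hle (hμ a).not_ge
    · have := hn 0
      rw [hν, mean_gaussianInstance, Fin.cons_zero] at this
      exact absurd this h₁.not_gt
  have h2 : (s.trajectoryLaw ν').real G ≤ δ := by
    have h := hs ν' (Or.inr hneg)
    have hd : Disjoint {ω | s.stopTime ω < ⊤ ∧ s.recommend ω ∈ ν'.correctAnswers μ₀} G := by
      refine Set.disjoint_left.2 ?_
      rintro ω ⟨-, (⟨⟨a, ha⟩, -⟩ | ⟨-, h⟩)⟩ ⟨h', -⟩
      · exact absurd ha (hneg a).not_gt
      · rw [Set.mem_preimage, h] at h'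
        simp at h'
    have h' := measureReal_union (μ := s.trajectoryLaw ν') hd
      ((historyFiltration (m + 1)).le n _ hG)
    have h'' := measureReal_le_one (μ := s.trajectoryLaw ν')
      (s := {ω | s.stopTime ω < ⊤ ∧ s.recommend ω ∈ ν'.correctAnswers μ₀} ∪ G)
    linarith
  have h3 : (s.trajectoryLaw ν).real G ^ 2 ≤ Real.exp 4 * (s.trajectoryLaw ν').real G := by
    refine sq_trajectoryLaw_real_le s (Fin.cons μ₁ μ) (Fin.cons (2 * μ₀ - μ₁) μ) hn hG fun ω _ => ?_
    calc _ ≤ ∑ t ∈ Finset.range n, (2 * (μ₁ - μ₀)) ^ 2 := by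
          refine Finset.sum_le_sum fun t _ => ?_
          refine Fin.cases ?_ (fun a => ?_) (ω t).1
          · simp only [Fin.cons_zero]
            exact le_of_eq (by ring)
          · simp only [Fin.cons_succ, sub_self, zero_pow two_ne_zero]
            positivity
      _ = 4 * (n * (μ₁ - μ₀) ^ 2) := by
          rw [Finset.sum_const, Finset.card_range, nsmul_eq_mul]
          ring
      _ ≤ 4 := by linarith
  -- The change of measure costs exp 4, as the means differ by 2 (μ₁ - μ₀). The tolerance exp (-8)
  -- absorbs this, and 1 - 1/25 - 1/5 ≥ 3/4.
  have h4 : Real.exp 4 * Real.exp (-8) = Real.exp (-2) ^ 2 := by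
    rw [← Real.exp_add, ← Real.exp_nat_mul]
    norm_num
  have h5 : (s.trajectoryLaw ν).real G ≤ Real.exp (-2) := by
    refine le_of_sq_le_sq ?_ (Real.exp_pos _).le
    rw [← h4]
    exact h3.trans (mul_le_mul_of_nonneg_left (h2.trans hδ.le) (Real.exp_pos _).le)
  have h6 : Real.exp (-2) ≤ 1 / 5 := by
    rw [Real.exp_neg, ← one_div]
    have : (5 : ℝ) ≤ Real.exp 2 := by
      have := Real.quadratic_le_exp_of_nonneg (show (0 : ℝ) ≤ 2 by norm_num)
      linarith
    gcongr
  have h7 : Real.exp (-8) ≤ 1 / 25 := by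
    have : Real.exp (-8) ≤ Real.exp (-2) * Real.exp (-2) := by
      rw [← Real.exp_add]
      exact Real.exp_le_exp.2 (by norm_num)
    nlinarith [Real.exp_pos (-2)]
  linarith

/-- The lower bound for one arm, given a bound `T` for the expected stopping time on the instances
in which the mean of this arm is reflected about the threshold. -/
theorem ofReal_le_expectedPullCount_of_expectedStop_le {m : ℕ} {μ₀ δ : ℝ} {μ : Fin m → ℝ}
    (hμ : ∀ a, μ a < μ₀) (hδ : δ < Real.exp (-8)) {s : PullingStrategy (m + 1)}
    (hs : s.IsDeltaPAC μ₀ δ) (a : Fin m) {T : ℝ} (hT : 1 ≤ T)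
    (hbound : ∀ ν : BanditInstance (m + 1), ν.IsPositiveWithGap μ₀ (μ₀ - μ a) →
      s.expectedStop ν ≤ ENNReal.ofReal T)
    {μ₁ : ℝ} (h₁ : μ₀ < μ₁) (h₁T : μ₁ ≤ μ₀ + 1 / (32 * T)) :
    ENNReal.ofReal (1 / 16 * (Real.log (1 / (μ₁ - μ₀) ^ 2) / (μ₁ - μ a) ^ 2)) ≤
      s.expectedPullCount (gaussianInstance (Fin.cons μ₁ μ)) a.succ := by
  set Δ := μ₁ - μ₀ with hΔ
  have hΔ0 : 0 < Δ := sub_pos.2 h₁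
  have hg : 0 < μ₀ - μ a := sub_pos.2 (hμ a)
  set D := 1 / Δ ^ 2 with hD
  have hDT : (32 * T) ^ 2 ≤ D := by
    have h : Δ ≤ 1 / (32 * T) := by linarith
    rw [hD, le_div_iff₀ (by positivity), ← mul_pow]
    rw [le_div_iff₀ (by positivity)] at h
    exact pow_le_one₀ (by positivity) (by linarith)
  have hD1 : 1 ≤ D := le_trans (by nlinarith) hDT
  set n := ⌊D⌋₊ with hn
  have hn0 : 0 < n := Nat.floor_pos.2 hD1
  have hnD : (n : ℝ) ≤ D := Nat.floor_le (by linarith)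
  have hDn : D ≤ 2 * n := by
    have h1 : D < n + 1 := Nat.lt_floor_add_one D
    have h2 : (1 : ℝ) ≤ n := by exact_mod_cast hn0
    linarith
  set d := 2 * (μ₀ - μ a) with hd
  have hd0 : 0 < d := by linarith
  -- Chosen so that exp (d² k) · T / n = D / (32 n) ≤ 1/16, the square of 1/4. Since D ≥ (32 T)²,
  -- dividing by 32 T costs at most half of log D.
  set k := Real.log (D / (32 * T)) / d ^ 2 with hk
  have hlog : Real.log D / 2 ≤ Real.log (D / (32 * T)) := by
    rw [Real.log_div (x := D) (y := 32 * T) (by positivity) (by positivity)]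
    have h := Real.log_le_log (by positivity) hDT
    rw [Real.log_pow] at h
    push_cast at h
    linarith
  have hL0 : 0 ≤ Real.log D := Real.log_nonneg hD1
  have hk0 : 0 ≤ k := by
    have : 0 ≤ Real.log (D / (32 * T)) := by linarith
    positivity
  let P := s.trajectoryLaw (gaussianInstance (Fin.cons μ₁ μ))
  have hlate : 3 / 4 ≤ P.real {ω | (n : ℕ∞) < s.stopTime ω} := by
    refine three_quarters_le_trajectoryLaw_lt_stopTime hμ hδ hs h₁ hn0 ?_
    rw [hD, le_div_iff₀ (by positivity)] at hnD
    exact hnD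
  let F : Set (Trajectory (m + 1)) :=
    {ω | (n : ℕ∞) < s.stopTime ω ∧ (pullsBefore a.succ n ω : ℝ) ≤ k}
  have hF : MeasurableSet[historyFiltration (m + 1) n] F := by
    refine (measurableSet_lt_stopTime s n).inter ?_
    exact measurable_pullsBefore a.succ n (measurableSet_le (f := fun i : ℕ => (i : ℝ))
      measurable_from_nat measurable_const)
  -- Arm a now exceeds μ₀ by μ₀ - μ a, whatever μ₁ is, so `hbound` applies with the same T.
  let μ' : Fin (m + 1) → ℝ := Function.update (Fin.cons μ₁ μ) a.succ (2 * μ₀ - μ a)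
  have hF1 : P.real F ^ 2 ≤
      Real.exp (d ^ 2 * k) * (s.trajectoryLaw (gaussianInstance μ')).real F := by
    refine sq_trajectoryLaw_real_le s _ _ hn0 hF fun ω hω => ?_
    calc _ = ∑ t ∈ Finset.range n, if (ω t).1 = a.succ then d ^ 2 else 0 := by
          refine Finset.sum_congr rfl fun t _ => ?_
          split_ifs with h
          · simp only [h, μ', Function.update_self, Fin.cons_succ, hd]
            ring
          · simp [μ', Function.update_of_ne h]
      _ = d ^ 2 * pullsBefore a.succ n ω := by
          rw [← Finset.sum_filter, Finset.sum_const, nsmul_eq_mul, mul_comm]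
          rfl
      _ ≤ d ^ 2 * k := by gcongr; exact hω.2
  have hF2 : n * (s.trajectoryLaw (gaussianInstance μ')).real F ≤ T := by
    refine le_trans ?_ (mul_trajectoryLaw_lt_stopTime_le s (gaussianInstance μ') (hbound _ ?_)
      (by linarith) n)
    · exact mul_le_mul_of_nonneg_left
        (measureReal_mono (show F ⊆ {ω | (n : ℕ∞) < s.stopTime ω} from fun ω hω => hω.1))
        (Nat.cast_nonneg n)
    · refine ⟨a.succ, ?_⟩
      rw [mean_gaussianInstance]
      simp only [μ', Function.update_self]
      linarith
  have hF3 : P.real F ≤ 1 / 4 := by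
    refine le_of_sq_le_sq (hF1.trans ?_) (by norm_num)
    have he : Real.exp (d ^ 2 * k) = D / (32 * T) := by
      rw [hk, mul_div_cancel₀ _ (by positivity), Real.exp_log (by positivity)]
    rw [he, div_mul_eq_mul_div, div_le_iff₀ (by positivity)]
    have := mul_le_mul_of_nonneg_right hDn
      (measureReal_nonneg (μ := s.trajectoryLaw (gaussianInstance μ')) (s := F))
    linarith
  have hS : 1 / 2 ≤ P.real {ω | (n : ℕ∞) < s.stopTime ω ∧ k < pullsBefore a.succ n ω} := by
    have h : P.real {ω | (n : ℕ∞) < s.stopTime ω} ≤ P.real F +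
        P.real {ω | (n : ℕ∞) < s.stopTime ω ∧ k < pullsBefore a.succ n ω} := by
      refine (measureReal_mono fun ω hω => ?_).trans (measureReal_union_le _ _)
      rcases le_or_gt (pullsBefore a.succ n ω : ℝ) k with h | h
      · exact Or.inl ⟨hω, h⟩
      · exact Or.inr ⟨hω, h⟩
    linarith
  refine (ENNReal.ofReal_le_ofReal ?_).trans (ofReal_mul_le_expectedPullCount s _ a.succ n hS hk0)
  -- The 1/16 collects 1/2 from `hlog`, 1/4 from d² = 4 (μ₀ - μ a)², and the probability 1/2.
  calc 1 / 16 * (Real.log D / (μ₁ - μ a) ^ 2)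
      ≤ 1 / 16 * (Real.log D / (μ₀ - μ a) ^ 2) := by gcongr
    _ = Real.log D / 2 / d ^ 2 * (1 / 2) := by
      rw [hd]
      field_simp
      ring
    _ ≤ k * (1 / 2) := by rw [hk]; gcongr

end OneIdentification

theorem mainTheorem6 :
    ∃ c : ℝ, 0 < c ∧
      ∀ (m : ℕ) (μ₀ : ℝ) (μ : Fin m → ℝ), Antitone μ → (∀ a, μ a < μ₀) →
        ∀ δ : ℝ, 0 < δ → δ < Real.exp (-8) →
          ∀ s : OneIdentification.PullingStrategy (m + 1), s.IsGapDeltaPAC μ₀ δ →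
            ∃ Δbar : ℝ, 0 < Δbar ∧
              ∀ μ₁ : ℝ, μ₀ < μ₁ → μ₁ ≤ μ₀ + Δbar →
                ∀ a : Fin m,
                  ENNReal.ofReal (c * (Real.log (1 / (μ₁ - μ₀) ^ 2) / (μ₁ - μ a) ^ 2)) ≤
                    s.expectedPullCount (OneIdentification.gaussianInstance (Fin.cons μ₁ μ)) a.succ := by
  refine ⟨1 / 16, by norm_num, fun m μ₀ μ _ hμ δ _ hδ s hs => ?_⟩
  have hT : ∀ a : Fin m, ∃ T : ℝ, 0 ≤ T ∧ ∀ ν : OneIdentification.BanditInstance (m + 1),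
      ν.IsPositiveWithGap μ₀ (μ₀ - μ a) → s.expectedStop ν ≤ ENNReal.ofReal T := by
    intro a
    refine ⟨ENNReal.toReal (⨆ ν ∈ {ν : OneIdentification.BanditInstance (m + 1) |
      ν.IsPositiveWithGap μ₀ (μ₀ - μ a) ∨ ν.IsNegativeWithGap μ₀ (μ₀ - μ a)}, s.expectedStop ν),
      ENNReal.toReal_nonneg, fun ν hν => ?_⟩
    rw [ENNReal.ofReal_toReal (hs.2 (μ₀ - μ a) (sub_pos.2 (hμ a))).ne]
    exact le_iSup₂ (f := fun ν _ => s.expectedStop ν) ν (Or.inl hν)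
  choose T hT0 hT using hT
  have hsum : 0 ≤ ∑ a, T a := Finset.sum_nonneg fun a _ => hT0 a
  -- One plus the sum dominates every T a and is at least 1, so a single bound serves all arms, even
  -- when there are none.
  refine ⟨1 / (32 * (1 + ∑ a, T a)), by positivity, fun μ₁ h₁ h₁T a => ?_⟩
  refine OneIdentification.ofReal_le_expectedPullCount_of_expectedStop_le hμ hδ hs.1 a
    (by linarith) (fun ν hν => (hT a ν hν).trans (ENNReal.ofReal_le_ofReal ?_)) h₁ h₁T
  have := Finset.single_le_sum (fun a _ => hT0 a) (Finset.mem_univ a)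
  linarith
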